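/- **Theorem (modified energy dissipation for the stabilized L2 Adams–Bashforth scheme).** Let $\Omega\subset\mathbb R^d$ be a bounded open set, with homogeneous Dirichlet, homogeneous Neumann, or periodic boundary conditions (in the periodic case $\Omega$ is a box), and let $V=H^1_0(\Omega)$, $H^1(\Omega)$ or $H^1_{\mathrm{per}}(\Omega)$ accordingly. Write $\|\cdot\|$ for the $L^2(\Omega)$ norm. Let $\alpha\in(0,1)$, $\gamma,\varepsilon,\Delta t>0$, $M\ge 1$, $L=3M^2-1$. Let $\tilde F:\mathbb R\to\mathbb R$ be the truncated double-well potential $$\tilde F(u)=\begin{cases}\frac12(3M^2-1)(u-M)^2+(M^3-M)(u-M)+\frac14(M^2-1)^2,&u\ge M,\\ \frac14(u^2-1)^2,&|u|\le M,\\ \frac12(3M^2-1)(u+M)^2-(M^3-M)(u+M)+\frac14(M^2-1)^2,&u\le -M,\end{cases}$$ $\tilde f=\tilde F'$, and $E(u)=\int_\Omega\big(\frac{\varepsilon^2}{2}|\nabla u|^2+\tilde F(u)\big)\,dx$. For $j\ge1$ put $$\begin{aligned}a_j&=-\tfrac32(2-\alpha)(j+1)^{1-\alpha}+\tfrac12(2-\alpha)j^{1-\alpha}+(j+1)^{2-\alpha}-j^{2-\alpha},\\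 b_j&=2(2-\alpha)(j+1)^{1-\alpha}-2(j+1)^{2-\alpha}+2j^{2-\alpha},\\ c_j&=-\tfrac12(2-\alpha)\big((j+1)^{1-\alpha}+j^{1-\alpha}\big)+(j+1)^{2-\alpha}-j^{2-\alpha},\end{aligned}$$ $d_1=c_1+2-2\alpha$, and $d_j=c_j-a_{j-1}$ for $j\ge2$. For $n\ge 2$ let $$L_n^\alpha u=\frac1{\Gamma(3-\alpha)\Delta t^\alpha}\Big\{\sum_{j=1}^{n-1}\big(a_ju^{n-j-1}+b_ju^{n-j}+c_ju^{n-j+1}\big)+\frac\alpha2u^{n-2}-2u^{n-1}+\frac{4-\alpha}2u^n\Big\}.$$ Let $N\in\mathbb N$ and $u^0,u^1,\dots,u^N\in V$ (with $u^0,u^1$ arbitrary) be such that, for $2\le n\le N$, $\Delta u^n\in L^2(\Omega)$ under the chosen boundary condition (in the usual weak sense) and $$L_n^\alpha u=\gamma\big[\varepsilon^2\Delta u^n-2\tilde f(u^{n-1})+\tilde f(u^{n-2})-S\Delta t\,(u^n-u^{n-1})\big]\quad\text{a.e. in }\Omega.$$ For $n\ge1$ put $$\tilde D^n=\frac1{\Gamma(3-\alpha)\Delta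 t^\alpha}\Big[\frac\alpha4\|u^n-u^{n-1}\|^2+\frac12\sum_{j=1}^{n-1}(d_{n-j}-d_{n-j+1})\|u^n-u^j\|^2+\frac{c_n}2\|u^n-u^1\|^2-\frac{a_n}2\|u^n-u^0\|^2\Big],$$ $$\tilde E(u^n)=E(u^n)+\frac1\gamma\tilde D^n+\frac L2\|u^n-u^{n-1}\|^2.$$ If $$S\ge\frac{3\alpha L}{2(1+\alpha)}\Big(\frac{3\gamma\,\Gamma(3-\alpha)L}{2\alpha(1+\alpha)}\Big)^{1/\alpha},$$ then $\tilde E(u^n)\le\tilde E(u^{n-1})$ for all $2\le n\le N$. -/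

import Mathlib

open MeasureTheory Filter Topology
open scoped ContDiff

noncomputable section

namespace TFAC

/-! ### Sobolev functions and boundary conditions -/

/-- Smooth functions on `ℝᵈ` whose support is a compact subset of `Ω`, i.e. `C_c^∞(Ω)`. -/
def IsTestFunction {d : ℕ} (Ω : Set (EuclideanSpace ℝ (Fin d)))
    (φ : EuclideanSpace ℝ (Fin d) → ℝ) : Prop :=
  ContDiff ℝ ∞ φ ∧ HasCompactSupport φ ∧ tsupport φ ⊆ Ω

/-- Smooth functions on `ℝᵈ` with period `ℓ i` in the `i`-th coordinate direction. -/
def IsSmoothPeriodic {d : ℕ} (ℓ : Fin d → ℝ) (φ : EuclideanSpace ℝ (Fin d) → ℝ) : Prop :=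
  ContDiff ℝ ∞ φ ∧ ∀ (i : Fin d) (x : EuclideanSpace ℝ (Fin d)),
    φ (x + EuclideanSpace.single i (ℓ i)) = φ x

/-- `g` is the weak gradient of `u` on `Ω`:
`∫_Ω u ∂ᵢφ = - ∫_Ω gᵢ φ` for all `φ ∈ C_c^∞(Ω)` and all `i`. -/
def IsWeakGradient {d : ℕ} (Ω : Set (EuclideanSpace ℝ (Fin d)))
    (u : EuclideanSpace ℝ (Fin d) → ℝ)
    (g : EuclideanSpace ℝ (Fin d) → EuclideanSpace ℝ (Fin d)) : Prop :=
  ∀ φ : EuclideanSpace ℝ (Fin d) → ℝ, IsTestFunction Ω φ → ∀ i : Fin d,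
    ∫ x in Ω, u x * gradient φ x i = - ∫ x in Ω, g x i * φ x

/-- An element of `H¹(Ω)`: a square integrable function on `Ω` together with its weak gradient,
which is square integrable (and is determined by the function up to null sets). -/
structure H1 {d : ℕ} (Ω : Set (EuclideanSpace ℝ (Fin d))) where
  toFun : EuclideanSpace ℝ (Fin d) → ℝ
  grad : EuclideanSpace ℝ (Fin d) → EuclideanSpace ℝ (Fin d)
  memLp_toFun : MemLp toFun 2 (volume.restrict Ω)
  memLp_grad : MemLp grad 2 (volume.restrict Ω)
  isWeakGradient : IsWeakGradient Ω toFun grad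

instance {d : ℕ} {Ω : Set (EuclideanSpace ℝ (Fin d))} :
    CoeFun (H1 Ω) (fun _ => EuclideanSpace ℝ (Fin d) → ℝ) := ⟨H1.toFun⟩

/-- `v` lies in the `H¹(Ω)`-closure of the class `T` of smooth functions. -/
def InClosure {d : ℕ} {Ω : Set (EuclideanSpace ℝ (Fin d))}
    (T : (EuclideanSpace ℝ (Fin d) → ℝ) → Prop) (v : H1 Ω) : Prop :=
  ∃ φ : ℕ → EuclideanSpace ℝ (Fin d) → ℝ, (∀ k, T (φ k)) ∧
    Tendsto (fun k => eLpNorm (fun x => φ k x - v x) 2 (volume.restrict Ω)) atTop (𝓝 0) ∧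
    Tendsto (fun k => eLpNorm (fun x => gradient (φ k) x - v.grad x) 2 (volume.restrict Ω))
      atTop (𝓝 0)

/-- Homogeneous Dirichlet, homogeneous Neumann, or periodic (with periods `ℓ i`) boundary
conditions. -/
inductive BoundaryCondition (d : ℕ) where
  | dirichlet : BoundaryCondition d
  | neumann : BoundaryCondition d
  | periodic (ℓ : Fin d → ℝ) : BoundaryCondition d

/-- Dirichlet and Neumann conditions make sense on every domain; periodic conditions are imposed
on a box `∏ᵢ (aᵢ, aᵢ + ℓᵢ)`. -/
def BoundaryCondition.Admissible {d : ℕ} (Ω : Set (EuclideanSpace ℝ (Fin d))) :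
    BoundaryCondition d → Prop
  | .dirichlet => True
  | .neumann => True
  | .periodic ℓ => (∀ i, 0 < ℓ i) ∧
      ∃ a : Fin d → ℝ, Ω = {x | ∀ i, a i < x i ∧ x i < a i + ℓ i}

/-- The energy space: `H¹₀(Ω)` (Dirichlet), `H¹(Ω)` (Neumann), `H¹_per(Ω)` (periodic). -/
def BoundaryCondition.EnergySpace {d : ℕ} {Ω : Set (EuclideanSpace ℝ (Fin d))} :
    BoundaryCondition d → H1 Ω → Prop
  | .dirichlet, v => InClosure (IsTestFunction Ω) v
  | .neumann, _ => True
  | .periodic ℓ, v => InClosure (IsSmoothPeriodic ℓ) v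

/-- `w ∈ L²(Ω)` is the Laplacian `Δu` of `u` under the given boundary condition.
Dirichlet: `u ∈ H¹₀(Ω)` and `Δu = w` in the sense of distributions on `Ω`.
Neumann: `Δu = w` in `Ω` and `∂u/∂ν = 0` on `∂Ω`, in the usual variational sense
(test functions in all of `H¹(Ω)`).
Periodic: `u ∈ H¹_per(Ω)` and `Δu = w` in the sense of periodic distributions. -/
def IsLaplacian {d : ℕ} {Ω : Set (EuclideanSpace ℝ (Fin d))}
    (bc : BoundaryCondition d) (u : H1 Ω) (w : EuclideanSpace ℝ (Fin d) → ℝ) : Prop :=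
  MemLp w 2 (volume.restrict Ω) ∧ bc.EnergySpace u ∧
  match bc with
  | .dirichlet => ∀ φ, IsTestFunction Ω φ →
      ∫ x in Ω, w x * φ x = - ∫ x in Ω, inner ℝ (u.grad x) (gradient φ x)
  | .neumann => ∀ v : H1 Ω,
      ∫ x in Ω, w x * v x = - ∫ x in Ω, inner ℝ (u.grad x) (v.grad x)
  | .periodic ℓ => ∀ φ, IsSmoothPeriodic ℓ φ →
      ∫ x in Ω, w x * φ x = - ∫ x in Ω, inner ℝ (u.grad x) (gradient φ x)

/-- `‖u - v‖²` in `L²(Ω)`. -/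
def distSq {d : ℕ} {Ω : Set (EuclideanSpace ℝ (Fin d))} (u v : H1 Ω) : ℝ :=
  ∫ x in Ω, (u x - v x) ^ 2

/-! ### The truncated double-well potential -/

/-- The truncated double-well potential `F̃`. -/
def truncF (M u : ℝ) : ℝ :=
  if M ≤ u then
    1 / 2 * (3 * M ^ 2 - 1) * (u - M) ^ 2 + (M ^ 3 - M) * (u - M) + 1 / 4 * (M ^ 2 - 1) ^ 2
  else if u ≤ -M then
    1 / 2 * (3 * M ^ 2 - 1) * (u + M) ^ 2 - (M ^ 3 - M) * (u + M) + 1 / 4 * (M ^ 2 - 1) ^ 2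
  else 1 / 4 * (u ^ 2 - 1) ^ 2

/-- `f̃ = F̃'`. -/
def truncf (M u : ℝ) : ℝ := deriv (truncF M) u

/-- The Ginzburg–Landau energy `∫_Ω (ε²/2 |∇u|² + F̃(u)) dx`. -/
def energy {d : ℕ} {Ω : Set (EuclideanSpace ℝ (Fin d))} (ε M : ℝ) (u : H1 Ω) : ℝ :=
  ∫ x in Ω, (ε ^ 2 / 2 * ‖u.grad x‖ ^ 2 + truncF M (u x))

/-! ### The L2 approximation of the Caputo derivative -/

def coefA (α : ℝ) (j : ℕ) : ℝ :=
  -(3 / 2) * (2 - α) * ((j : ℝ) + 1) ^ (1 - α) + 1 / 2 * (2 - α) * (j : ℝ) ^ (1 - α)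
    + ((j : ℝ) + 1) ^ (2 - α) - (j : ℝ) ^ (2 - α)

def coefB (α : ℝ) (j : ℕ) : ℝ :=
  2 * (2 - α) * ((j : ℝ) + 1) ^ (1 - α) - 2 * ((j : ℝ) + 1) ^ (2 - α) + 2 * (j : ℝ) ^ (2 - α)

def coefC (α : ℝ) (j : ℕ) : ℝ :=
  -(1 / 2) * (2 - α) * (((j : ℝ) + 1) ^ (1 - α) + (j : ℝ) ^ (1 - α))
    + ((j : ℝ) + 1) ^ (2 - α) - (j : ℝ) ^ (2 - α)

/-- `d₁ = c₁ + 2 - 2α` and `d_j = c_j - a_{j-1}` for `j ≥ 2`. -/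
def coefD (α : ℝ) (j : ℕ) : ℝ :=
  if j = 1 then coefC α 1 + 2 - 2 * α else coefC α j - coefA α (j - 1)

/-- The L2 approximation `L_n^α v` of the Caputo derivative at step `n ≥ 2`, with time step `τ`,
for a sequence `v` of real numbers (the values of `u⁰, u¹, …` at a point). -/
def L2Caputo (α τ : ℝ) (v : ℕ → ℝ) (n : ℕ) : ℝ :=
  1 / (Real.Gamma (3 - α) * τ ^ α) *
    (∑ j ∈ Finset.Icc 1 (n - 1),
        (coefA α j * v (n - j - 1) + coefB α j * v (n - j) + coefC α j * v (n - j + 1))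
      + α / 2 * v (n - 2) - 2 * v (n - 1) + (4 - α) / 2 * v n)

/-- The nonlocal term `D̃ⁿ`, `n ≥ 1` (the sum is empty for `n = 1`). -/
def nonlocalTerm {d : ℕ} {Ω : Set (EuclideanSpace ℝ (Fin d))} (α τ : ℝ) (u : ℕ → H1 Ω)
    (n : ℕ) : ℝ :=
  1 / (Real.Gamma (3 - α) * τ ^ α) *
    (α / 4 * distSq (u n) (u (n - 1))
      + 1 / 2 * ∑ j ∈ Finset.Icc 1 (n - 1),
          (coefD α (n - j) - coefD α (n - j + 1)) * distSq (u n) (u j)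
      + coefC α n / 2 * distSq (u n) (u 1) - coefA α n / 2 * distSq (u n) (u 0))

/-- The modified energy `Ẽ(uⁿ)`, `n ≥ 1`. -/
def modifiedEnergy {d : ℕ} {Ω : Set (EuclideanSpace ℝ (Fin d))} (α γ ε M τ : ℝ) (u : ℕ → H1 Ω)
    (n : ℕ) : ℝ :=
  energy ε M (u n) + 1 / γ * nonlocalTerm α τ u n
    + 1 / 2 * (3 * M ^ 2 - 1) * distSq (u n) (u (n - 1))

/-- One step `n ≥ 2` of the stabilized second-order Adams–Bashforth L2 scheme
`L_n^α u = γ (ε² Δuⁿ - 2 f̃(uⁿ⁻¹) + f̃(uⁿ⁻²) - S τ (uⁿ - uⁿ⁻¹))`, an identity in `L²(Ω)`. -/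
def SchemeStep {d : ℕ} {Ω : Set (EuclideanSpace ℝ (Fin d))} (bc : BoundaryCondition d)
    (α γ ε M S τ : ℝ) (u : ℕ → H1 Ω) (n : ℕ) : Prop :=
  ∃ w : EuclideanSpace ℝ (Fin d) → ℝ, IsLaplacian bc (u n) w ∧
    ∀ᵐ x ∂(volume.restrict Ω),
      L2Caputo α τ (fun k => u k x) n =
        γ * (ε ^ 2 * w x - 2 * truncf M (u (n - 1) x) + truncf M (u (n - 2) x)
          - S * τ * (u n x - u (n - 1) x))

end TFAC

end

namespace TFAC

/-! Everything except the Laplacian is estimated pointwise in `x`. Write δₙ = uⁿ - uⁿ⁻¹, K = 1 /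
(Γ(3-α) τ^α), L = 3M² - 1, and multiply the scheme by δₙ.

Memory: summation by parts (`L2Caputo_eq`) turns the discrete derivative into weighted differences
uⁿ - uʲ plus two local increments. The identity 2(x-z)(x-y) = (x-z)² - (y-z)² + (x-y)² then bounds
its product with δₙ from below by the increment of the nonlocal term plus K α δₙ²
(`scalarNonlocal_sub_le`). The discarded terms have the right sign because a_j increases, c_j
decreases, d_j is convex in j and d₁ ≥ 0. These facts come from writing a_j and c_j as integrals of
(j+1-θ)^(-α) against θ - 3/2 and θ - 1/2.

Nonlinearity: since F̃'' ≤ L and f̃ is L-Lipschitz, the explicit treatment of f̃, together with the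
term L/2 δₙ² of the modified energy, costs at most 3L/2 δₙ². `stabilization_le` shows that K α/γ + S
τ pays for this at every step size τ: the term K α/γ dominates for small τ and S τ for large τ.

Diffusion: after integration, Green's formula and Young's inequality bound the Laplacian term by the
decrease of the gradient energy. -/

/-! ### Integral representations and monotonicity of the coefficients -/

/-- Antitone functions have nonnegative correlation with `θ ↦ θ - 1/2` after reflection. -/
theorem integral_sub_half_mul_nonneg {g : ℝ → ℝ} (hc : ContinuousOn g (Set.Icc 0 1))
    (hg : MonotoneOn g (Set.Icc 0 1)) :
    0 ≤ ∫ θ in (0 : ℝ)..1, (θ - 1 / 2) * g θ := by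
  -- The weight θ - 1/2 has mean zero, so `g` may be compared with the constant g(1/2). Monotonicity
  -- makes the difference have the sign of θ - 1/2.
  have h0 : ∫ θ in (0 : ℝ)..1, (θ - 1 / 2) * g (1 / 2) = 0 := by
    rw [intervalIntegral.integral_mul_const, intervalIntegral.integral_sub (by simp) (by simp)]
    simp
  refine h0.symm.le.trans ?_
  apply intervalIntegral.integral_mono_on (by norm_num)
  · exact (Continuous.intervalIntegrable (by fun_prop) _ _)
  · apply ContinuousOn.intervalIntegrable
    rw [Set.uIcc_of_le (by norm_num)]
    fun_prop
  · intro θ hθ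
    rcases le_total θ (1 / 2) with h | h
    · exact mul_le_mul_of_nonpos_left (hg hθ (by norm_num) h) (by linarith)
    · exact mul_le_mul_of_nonneg_left (hg (by norm_num) hθ h) (by linarith)

/-- An explicit antiderivative exists; the prefactor clears its denominators, so no condition on `α`
is needed. The choices b = 3/2 and b = 1/2 give a_j and c_j. -/
theorem integral_linear_mul_rpow {α x : ℝ} (hx : 1 ≤ x) (b : ℝ) :
    (1 - α) * (2 - α) * ∫ θ in (0 : ℝ)..1, (θ - b) * (x + 1 - θ) ^ (-α) =
      -(2 - α) * (1 - b) * x ^ (1 - α) - (2 - α) * b * (x + 1) ^ (1 - α)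
        + (x + 1) ^ (2 - α) - x ^ (2 - α) := by
  have key : ∀ θ ∈ Set.uIcc (0 : ℝ) 1, HasDerivAt
      (fun θ : ℝ => -(2 - α) * (θ - b) * (x + 1 - θ) ^ (1 - α) - (x + 1 - θ) ^ (2 - α))
      ((1 - α) * (2 - α) * ((θ - b) * (x + 1 - θ) ^ (-α))) θ := by
    intro θ hθ
    rw [Set.uIcc_of_le (by norm_num)] at hθ
    have hpos : 0 < x + 1 - θ := by linarith [hθ.2]
    have hd : HasDerivAt (fun θ : ℝ => x + 1 - θ) (-1) θ := by
      simpa using (hasDerivAt_id θ).const_sub (x + 1)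
    have e1 := hd.rpow_const (p := 1 - α) (Or.inl hpos.ne')
    have e2 := hd.rpow_const (p := 2 - α) (Or.inl hpos.ne')
    have e3 : HasDerivAt (fun θ : ℝ => -(2 - α) * (θ - b)) (-(2 - α)) θ := by
      simpa using ((hasDerivAt_id θ).sub_const b).const_mul (-(2 - α))
    rw [show 1 - α - 1 = -α by ring] at e1
    rw [show 2 - α - 1 = 1 - α by ring] at e2
    refine ((e3.mul e1).sub e2).congr_deriv ?_
    ring
  rw [← intervalIntegral.integral_const_mul, intervalIntegral.integral_eq_sub_of_hasDerivAt key]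
  · rw [show x + 1 - 1 = x by ring, show x + 1 - 0 = x + 1 by ring]
    ring
  · apply ContinuousOn.intervalIntegrable
    rw [Set.uIcc_of_le (by norm_num)]
    apply ContinuousOn.mul continuousOn_const
    apply ContinuousOn.mul (by fun_prop)
    apply ContinuousOn.rpow_const (by fun_prop)
    intro θ hθ
    left
    linarith [hθ.2]

theorem coefA_eq_integral (α : ℝ) {j : ℕ} (hj : 1 ≤ j) :
    coefA α j =
      (1 - α) * (2 - α) * ∫ θ in (0 : ℝ)..1, (θ - 3 / 2) * ((j : ℝ) + 1 - θ) ^ (-α) := by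
  rw [integral_linear_mul_rpow (by exact_mod_cast hj), coefA]
  ring

theorem coefC_eq_integral (α : ℝ) {j : ℕ} (hj : 1 ≤ j) :
    coefC α j =
      (1 - α) * (2 - α) * ∫ θ in (0 : ℝ)..1, (θ - 1 / 2) * ((j : ℝ) + 1 - θ) ^ (-α) := by
  rw [integral_linear_mul_rpow (by exact_mod_cast hj), coefC]
  ring

theorem continuousOn_sub_rpow (p : ℝ) {x : ℝ} (hx : 1 < x) :
    ContinuousOn (fun θ : ℝ => (x - θ) ^ p) (Set.Icc 0 1) := by
  apply ContinuousOn.rpow_const (by fun_prop)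
  intro θ hθ
  left
  linarith [hθ.2]

theorem intervalIntegrable_linear_mul_sub_rpow (b p : ℝ) {x : ℝ} (hx : 1 < x) :
    IntervalIntegrable (fun θ : ℝ => (θ - b) * (x - θ) ^ p) volume 0 1 := by
  apply ContinuousOn.intervalIntegrable
  rw [Set.uIcc_of_le (by norm_num)]
  exact ContinuousOn.mul (by fun_prop) (continuousOn_sub_rpow p hx)

/-- Midpoint convexity of a negative power. -/
theorem two_mul_rpow_le {p x : ℝ} (hp : p ≤ 0) (hx : 1 < x) :
    2 * x ^ p ≤ (x - 1) ^ p + (x + 1) ^ p := by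
  have h1 : 0 < x - 1 := by linarith
  have h2 : 0 < x + 1 := by linarith
  -- A nonpositive power reverses (x-1)(x+1) ≤ x². The geometric mean of the two outer powers is
  -- then at most their arithmetic mean.
  have h : x ^ p * x ^ p ≤ (x - 1) ^ p * (x + 1) ^ p := by
    rw [← Real.mul_rpow (by linarith) (by linarith), ← Real.mul_rpow h1.le h2.le]
    exact Real.rpow_le_rpow_of_nonpos (by positivity) (by nlinarith) hp
  have hx0 : 0 ≤ x ^ p := Real.rpow_nonneg (by linarith) _
  have ha : 0 ≤ (x - 1) ^ p := Real.rpow_nonneg h1.le _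
  have hb : 0 ≤ (x + 1) ^ p := Real.rpow_nonneg h2.le _
  nlinarith [sq_nonneg ((x - 1) ^ p - (x + 1) ^ p)]

/-- The weight θ - 3/2 is negative on [0, 1] and the kernel (j+1-θ)^(-α) decreases in j, so the
integrands compare pointwise. -/
theorem coefA_le_succ {α : ℝ} (hα0 : 0 < α) (hα1 : α < 1) {j : ℕ} (hj : 1 ≤ j) :
    coefA α j ≤ coefA α (j + 1) := by
  have hj' : (1 : ℝ) ≤ j := by exact_mod_cast hj
  rw [coefA_eq_integral α hj, coefA_eq_integral α (by lia)]
  push_cast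
  apply mul_le_mul_of_nonneg_left _ (mul_nonneg (by linarith) (by linarith))
  apply intervalIntegral.integral_mono_on (by norm_num)
    (intervalIntegrable_linear_mul_sub_rpow _ _ (by linarith))
    (intervalIntegrable_linear_mul_sub_rpow _ _ (by linarith))
  intro θ hθ
  apply mul_le_mul_of_nonpos_left _ (by linarith [hθ.2])
  exact Real.rpow_le_rpow_of_nonpos (by linarith [hθ.2]) (by linarith) (by linarith)

/-- The kernel is midpoint convex in j, and the negative weight reverses the inequality. -/
theorem coefA_secondDiff_nonpos {α : ℝ} (hα0 : 0 < α) (hα1 : α < 1) {j : ℕ} (hj : 1 ≤ j) :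
    coefA α j - 2 * coefA α (j + 1) + coefA α (j + 2) ≤ 0 := by
  have hj' : (1 : ℝ) ≤ j := by exact_mod_cast hj
  have h : ∫ θ in (0 : ℝ)..1, (2 * ((θ - 3 / 2) * ((j : ℝ) + 1 + 1 - θ) ^ (-α)) -
      ((θ - 3 / 2) * ((j : ℝ) + 1 - θ) ^ (-α) + (θ - 3 / 2) * ((j : ℝ) + 2 + 1 - θ) ^ (-α))) ≥ 0 := by
    apply intervalIntegral.integral_nonneg (by norm_num)
    intro θ hθ
    have := two_mul_rpow_le (p := -α) (x := (j : ℝ) + 1 + 1 - θ) (by linarith) (by linarith [hθ.2])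
    rw [show (j : ℝ) + 1 + 1 - θ - 1 = j + 1 - θ by ring,
      show (j : ℝ) + 1 + 1 - θ + 1 = j + 2 + 1 - θ by ring] at this
    nlinarith [hθ.2]
  have i1 := intervalIntegrable_linear_mul_sub_rpow (3 / 2) (-α) (x := (j : ℝ) + 1) (by linarith)
  have i2 := intervalIntegrable_linear_mul_sub_rpow (3 / 2) (-α) (x := (j : ℝ) + 1 + 1)
    (by linarith)
  have i3 := intervalIntegrable_linear_mul_sub_rpow (3 / 2) (-α) (x := (j : ℝ) + 2 + 1)
    (by linarith)
  rw [intervalIntegral.integral_sub (i2.const_mul 2) (i1.add i3),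
    intervalIntegral.integral_const_mul, intervalIntegral.integral_add i1 i3] at h
  rw [coefA_eq_integral α hj, coefA_eq_integral α (show 1 ≤ j + 1 by lia),
    coefA_eq_integral α (show 1 ≤ j + 2 by lia)]
  push_cast
  have hP : 0 ≤ (1 - α) * (2 - α) := mul_nonneg (by linarith) (by linarith)
  nlinarith [mul_nonneg hP h]

theorem hasDerivAt_add_const_rpow (p b : ℝ) {x : ℝ} (hx : 0 < x + b) :
    HasDerivAt (fun y : ℝ => (y + b) ^ p) (p * (x + b) ^ (p - 1)) x := by
  simpa using ((hasDerivAt_id x).add_const b).rpow_const (p := p) (Or.inl hx.ne')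

theorem antitoneOn_rpow_sub_rpow_add_one {p : ℝ} (hp : p ≤ 0) :
    AntitoneOn (fun x : ℝ => x ^ p - (x + 1) ^ p) (Set.Ioi 0) := by
  have hd : ∀ x ∈ Set.Ioi (0 : ℝ), HasDerivAt (fun x : ℝ => x ^ p - (x + 1) ^ p)
      (p * x ^ (p - 1) - p * (x + 1) ^ (p - 1)) x := fun x hx =>
    (Real.hasDerivAt_rpow_const (Or.inl (ne_of_gt hx))).sub
      (hasDerivAt_add_const_rpow p 1 (add_pos hx one_pos))
  apply antitoneOn_of_hasDerivWithinAt_nonpos (convex_Ioi 0)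
    (fun x hx => (hd x hx).continuousAt.continuousWithinAt)
    (fun x hx => (hd x (interior_subset hx)).hasDerivWithinAt)
  intro x hx
  have hx0 : 0 < x := interior_subset hx
  have := Real.rpow_le_rpow_of_nonpos hx0 (by linarith : x ≤ x + 1) (by linarith : p - 1 ≤ 0)
  nlinarith

/-- The derivative is p ≤ 0 times the second difference of the power p - 1, which is nonnegative by
`two_mul_rpow_le`. -/
theorem antitoneOn_secondDiff_rpow {p : ℝ} (hp : p ≤ 0) :
    AntitoneOn (fun x : ℝ => (x + -1) ^ p - 2 * x ^ p + (x + 1) ^ p) (Set.Ioi 1) := by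
  have hd : ∀ x ∈ Set.Ioi (1 : ℝ),
      HasDerivAt (fun x : ℝ => (x + -1) ^ p - 2 * x ^ p + (x + 1) ^ p)
      (p * (x + -1) ^ (p - 1) - 2 * (p * x ^ (p - 1)) + p * (x + 1) ^ (p - 1)) x := by
    intro x hx
    have hx1 : 1 < x := hx
    exact ((hasDerivAt_add_const_rpow p (-1) (by linarith)).sub
      ((Real.hasDerivAt_rpow_const (Or.inl (by linarith))).const_mul 2)).add
      (hasDerivAt_add_const_rpow p 1 (by linarith))
  apply antitoneOn_of_hasDerivWithinAt_nonpos (convex_Ioi 1)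
    (fun x hx => (hd x hx).continuousAt.continuousWithinAt)
    (fun x hx => (hd x (interior_subset hx)).hasDerivWithinAt)
  intro x hx
  have hx0 : 1 < x := interior_subset hx
  have := two_mul_rpow_le (by linarith : p - 1 ≤ 0) hx0
  rw [sub_eq_add_neg x 1] at this
  nlinarith

/-- The weight θ - 1/2 changes sign, so pointwise comparison is unavailable. Instead, the difference
of consecutive kernels increases in θ, and `integral_sub_half_mul_nonneg` applies. -/
theorem coefC_succ_le {α : ℝ} (hα0 : 0 < α) (hα1 : α < 1) {j : ℕ} (hj : 1 ≤ j) :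
    coefC α (j + 1) ≤ coefC α j := by
  have hj' : (1 : ℝ) ≤ j := by exact_mod_cast hj
  have i1 := intervalIntegrable_linear_mul_sub_rpow (1 / 2) (-α) (x := (j : ℝ) + 1) (by linarith)
  have i2 := intervalIntegrable_linear_mul_sub_rpow (1 / 2) (-α) (x := (j : ℝ) + 1 + 1)
    (by linarith)
  have h := integral_sub_half_mul_nonneg
    (g := fun θ => ((j : ℝ) + 1 - θ) ^ (-α) - ((j : ℝ) + 1 + 1 - θ) ^ (-α))
    ((continuousOn_sub_rpow _ (by linarith)).sub (continuousOn_sub_rpow _ (by linarith))) (by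
      intro s hs t ht hst
      have := antitoneOn_rpow_sub_rpow_add_one (p := -α) (by linarith)
        (show (j : ℝ) + 1 - t ∈ Set.Ioi 0 by simp only [Set.mem_Ioi]; linarith [ht.2])
        (show (j : ℝ) + 1 - s ∈ Set.Ioi 0 by simp only [Set.mem_Ioi]; linarith [hs.2])
        (by linarith)
      simpa only [sub_add_eq_add_sub] using this)
  simp only [mul_sub] at h
  rw [intervalIntegral.integral_sub i1 i2] at h
  rw [coefC_eq_integral α hj, coefC_eq_integral α (show 1 ≤ j + 1 by lia)]
  push_cast
  have hP : 0 ≤ (1 - α) * (2 - α) := mul_nonneg (by linarith) (by linarith)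
  exact mul_le_mul_of_nonneg_left (by linarith) hP

theorem coefC_secondDiff_nonneg {α : ℝ} (hα0 : 0 < α) (hα1 : α < 1) {j : ℕ} (hj : 1 ≤ j) :
    0 ≤ coefC α j - 2 * coefC α (j + 1) + coefC α (j + 2) := by
  have hj' : (1 : ℝ) ≤ j := by exact_mod_cast hj
  have i1 := intervalIntegrable_linear_mul_sub_rpow (1 / 2) (-α) (x := (j : ℝ) + 1) (by linarith)
  have i2 := intervalIntegrable_linear_mul_sub_rpow (1 / 2) (-α) (x := (j : ℝ) + 1 + 1)
    (by linarith)
  have i3 := intervalIntegrable_linear_mul_sub_rpow (1 / 2) (-α) (x := (j : ℝ) + 2 + 1)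
    (by linarith)
  have h := integral_sub_half_mul_nonneg
    (g := fun θ => ((j : ℝ) + 1 - θ) ^ (-α) - 2 * ((j : ℝ) + 1 + 1 - θ) ^ (-α)
      + ((j : ℝ) + 2 + 1 - θ) ^ (-α))
    (((continuousOn_sub_rpow _ (by linarith)).sub
      ((continuousOn_sub_rpow _ (by linarith)).const_mul 2)).add
      (continuousOn_sub_rpow _ (by linarith))) (by
      intro s hs t ht hst
      have := antitoneOn_secondDiff_rpow (p := -α) (by linarith)
        (show (j : ℝ) + 1 + 1 - t ∈ Set.Ioi 1 by simp only [Set.mem_Ioi]; linarith [ht.2])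
        (show (j : ℝ) + 1 + 1 - s ∈ Set.Ioi 1 by simp only [Set.mem_Ioi]; linarith [hs.2])
        (by linarith)
      have e1 : ∀ r : ℝ, (j : ℝ) + 1 + 1 - r + -1 = j + 1 - r := fun r => by ring
      have e2 : ∀ r : ℝ, (j : ℝ) + 1 + 1 - r + 1 = j + 2 + 1 - r := fun r => by ring
      simpa only [e1, e2] using this)
  simp only [mul_add, mul_sub, mul_left_comm _ (2 : ℝ) _] at h
  rw [intervalIntegral.integral_add (i1.sub (i2.const_mul 2)) i3,
    intervalIntegral.integral_sub i1 (i2.const_mul 2), intervalIntegral.integral_const_mul] at h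
  rw [coefC_eq_integral α hj, coefC_eq_integral α (show 1 ≤ j + 1 by lia),
    coefC_eq_integral α (show 1 ≤ j + 2 by lia)]
  push_cast
  have hP : 0 ≤ (1 - α) * (2 - α) := mul_nonneg (by linarith) (by linarith)
  nlinarith [mul_nonneg hP h]

/-! ### Sign and convexity of the coefficients d_j. -/

theorem coefD_one_nonneg {α : ℝ} (hα0 : 0 < α) (hα1 : α < 1) : 0 ≤ coefD α 1 := by
  have e : (2 : ℝ) ^ (2 - α) = 2 * 2 ^ (1 - α) := by
    rw [show 2 - α = 1 + (1 - α) by ring, Real.rpow_add (by norm_num), Real.rpow_one]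
  have hp : (1 : ℝ) ≤ 2 ^ (1 - α) := Real.one_le_rpow (by norm_num) (by linarith)
  simp only [coefD, coefC, if_true, Nat.cast_one, Real.one_rpow]
  norm_num [e]
  nlinarith

/-- This is what the exceptional value of d₁ adds to the second difference of c in d₁ - 2d₂ + d₃.
With s = 1 - α, Bernoulli's inequality controls 2^s from both sides and 3^s = 2^s (3/2)^s from
above. -/
theorem two_add_two_mul_coefA_sub_coefA_nonneg {α : ℝ} (hα0 : 0 < α) (hα1 : α < 1) :
    0 ≤ 2 - 2 * α + 2 * coefA α 1 - coefA α 2 := by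
  have e2 : (2 : ℝ) ^ (2 - α) = 2 * 2 ^ (1 - α) := by
    rw [show 2 - α = 1 + (1 - α) by ring, Real.rpow_add (by norm_num), Real.rpow_one]
  have e3 : (3 : ℝ) ^ (2 - α) = 3 * 3 ^ (1 - α) := by
    rw [show 2 - α = 1 + (1 - α) by ring, Real.rpow_add (by norm_num), Real.rpow_one]
  have hp1 : (2 : ℝ) ^ (1 - α) ≤ 1 + (1 - α) := by
    have := rpow_one_add_le_one_add_mul_self (s := (1 : ℝ)) (p := 1 - α) (by norm_num)
      (by linarith) (by linarith)
    norm_num at this ⊢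
    linarith
  have hp2 : 1 + (1 - α) / 2 ≤ (2 : ℝ) ^ (1 - α) := by
    have h := rpow_one_add_le_one_add_mul_self (s := (-1 / 2 : ℝ)) (p := 1 - α) (by norm_num)
      (by linarith) (by linarith)
    rw [show (1 + -1 / 2 : ℝ) = 2⁻¹ by norm_num, Real.inv_rpow (by norm_num)] at h
    have hpos : (0 : ℝ) < 2 ^ (1 - α) := by positivity
    rw [inv_le_iff_one_le_mul₀ hpos] at h
    nlinarith
  have hq : (3 : ℝ) ^ (1 - α) ≤ 2 ^ (1 - α) * (1 + (1 - α) / 2) := by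
    have h := rpow_one_add_le_one_add_mul_self (s := (1 / 2 : ℝ)) (p := 1 - α) (by norm_num)
      (by linarith) (by linarith)
    rw [show (3 : ℝ) = 2 * (1 + 1 / 2) by norm_num, Real.mul_rpow (by norm_num) (by norm_num)]
    apply mul_le_mul_of_nonneg_left _ (by positivity)
    linarith
  simp only [coefA, Nat.cast_one, Nat.cast_ofNat, Real.one_rpow]
  norm_num only [e2, e3]
  generalize (2 : ℝ) ^ (1 - α) = p at *
  generalize (3 : ℝ) ^ (1 - α) = q at *
  obtain ⟨s, rfl⟩ : ∃ s, α = 1 - s := ⟨1 - α, by ring⟩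
  simp only [sub_sub_cancel] at hp1 hp2 hq
  have hs0 : 0 < s := by linarith
  have hs1 : s < 1 := by linarith
  have h1 : (1 - s) * q ≤ (1 - s) * (p * (1 + s / 2)) :=
    mul_le_mul_of_nonneg_left hq (by linarith)
  -- This is the expression left after bounding q by p(1 + s/2). It is affine in p, so the sign of
  -- the slope decides whether the lower bound 1 + s/2 or the upper bound 1 + s on p is used.
  have key : 0 ≤ 3 * s - 1 + p * (1 - 11 / 4 * s + 3 / 4 * s ^ 2) := by
    rcases le_total 0 (1 - 11 / 4 * s + 3 / 4 * s ^ 2) with h | h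
    · have := mul_le_mul_of_nonneg_right hp2 h
      nlinarith [pow_pos hs0 3, mul_pos hs0 (sub_pos.2 hs1)]
    · have := mul_le_mul_of_nonpos_right hp1 h
      nlinarith [mul_pos (mul_pos hs0 (sub_pos.2 hs1)) (by linarith : 0 < 5 / 4 - 3 / 4 * s)]
  nlinarith

/-- Convexity of `j ↦ d_j`. -/
theorem coefD_secondDiff_nonneg {α : ℝ} (hα0 : 0 < α) (hα1 : α < 1) {j : ℕ} (hj : 1 ≤ j) :
    0 ≤ coefD α j - 2 * coefD α (j + 1) + coefD α (j + 2) := by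
  have hC := coefC_secondDiff_nonneg hα0 hα1 hj
  obtain rfl | hj2 := hj.eq_or_lt
  · have := two_add_two_mul_coefA_sub_coefA_nonneg hα0 hα1
    simp only [coefD, if_true]
    norm_num at hC ⊢
    linarith
  · obtain ⟨k, rfl⟩ : ∃ k, j = k + 1 := ⟨j - 1, by lia⟩
    have hA := coefA_secondDiff_nonpos hα0 hα1 (show 1 ≤ k by lia)
    simp only [coefD, show k + 1 ≠ 1 by lia, show k + 1 + 1 ≠ 1 by lia,
      show k + 1 + 2 ≠ 1 by lia, if_false, Nat.add_sub_cancel,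
      show k + 1 + 2 - 1 = k + 2 by lia]
    linarith

/-! ### The truncated potential -/

theorem hasDerivAt_max_zero_pow (n : ℕ) (t : ℝ) :
    HasDerivAt (fun t : ℝ => max t 0 ^ (n + 2)) ((n + 2 : ℝ) * max t 0 ^ (n + 1)) t := by
  rcases lt_trichotomy t 0 with h | rfl | h
  · rw [max_eq_right h.le, zero_pow (by lia), mul_zero]
    apply (hasDerivAt_const t (0 : ℝ)).congr_of_eventuallyEq
    filter_upwards [eventually_lt_nhds h] with s hs
    rw [max_eq_right hs.le, zero_pow (by lia)]
  · rw [max_self, zero_pow (by lia), mul_zero, hasDerivAt_iff_isLittleO_nhds_zero]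
    have h2 : (fun h : ℝ => h ^ (n + 2)) =o[𝓝 0] fun h => h := by
      simpa using Asymptotics.isLittleO_pow_pow (𝕜 := ℝ) (show 1 < n + 2 by lia)
    refine (Asymptotics.isBigO_of_le _ fun h => ?_).trans_isLittleO h2
    simp only [zero_add, max_self, smul_zero, sub_zero, norm_pow, Real.norm_eq_abs,
      zero_pow (show n + 2 ≠ 0 by lia)]
    refine pow_le_pow_left₀ (abs_nonneg _) ?_ _
    rw [abs_of_nonneg (le_max_right h 0)]
    exact max_le (le_abs_self h) (abs_nonneg h)
  · rw [max_eq_left h.le]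
    have : HasDerivAt (fun t : ℝ => t ^ (n + 2)) ((n + 2 : ℝ) * t ^ (n + 1)) t := by
      simpa using hasDerivAt_pow (n + 2) t
    apply this.congr_of_eventuallyEq
    filter_upwards [eventually_gt_nhds h] with s hs
    rw [max_eq_left hs.le]

/-- Beyond ±M the potential is the second-order Taylor polynomial of the quartic, so exactly the
cubic and quartic Taylor terms are removed. Positive parts put all branches in one formula that can
be differentiated twice without cases. -/
theorem truncF_eq {M : ℝ} (hM : 1 ≤ M) (u : ℝ) :
    truncF M u = 1 / 4 * (u ^ 2 - 1) ^ 2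
      - (M * max (u - M) 0 ^ 3 + 1 / 4 * max (u - M) 0 ^ 4)
      - (M * max (-u - M) 0 ^ 3 + 1 / 4 * max (-u - M) 0 ^ 4) := by
  unfold truncF
  split_ifs with h1 h2
  · rw [max_eq_left (by linarith), max_eq_right (by linarith)]
    ring
  · rw [max_eq_right (by linarith), max_eq_left (by linarith)]
    ring
  · rw [max_eq_right (by linarith), max_eq_right (by linarith)]
    ring

theorem hasDerivAt_truncF {M : ℝ} (hM : 1 ≤ M) (u : ℝ) :
    HasDerivAt (truncF M) (u ^ 3 - u
      - (3 * M * max (u - M) 0 ^ 2 + max (u - M) 0 ^ 3)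
      + (3 * M * max (-u - M) 0 ^ 2 + max (-u - M) 0 ^ 3)) u := by
  rw [show truncF M = _ from funext (truncF_eq hM)]
  have a1 : HasDerivAt (fun u : ℝ => u - M) 1 u := (hasDerivAt_id u).sub_const M
  have a2 : HasDerivAt (fun u : ℝ => -u - M) (-1) u := (hasDerivAt_id u).neg.sub_const M
  have b1 := (hasDerivAt_max_zero_pow 1 (u - M)).comp u a1
  have b2 := (hasDerivAt_max_zero_pow 2 (u - M)).comp u a1
  have b3 := (hasDerivAt_max_zero_pow 1 (-u - M)).comp u a2
  have b4 := (hasDerivAt_max_zero_pow 2 (-u - M)).comp u a2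
  have b0 : HasDerivAt (fun u : ℝ => 1 / 4 * (u ^ 2 - 1) ^ 2) (u ^ 3 - u) u := by
    refine ((((hasDerivAt_id u).pow 2).sub_const 1).pow 2 |>.const_mul (1 / 4)).congr_deriv ?_
    simp
    ring
  refine ((b0.sub ((b1.const_mul M).add (b2.const_mul (1 / 4)))).sub
    ((b3.const_mul M).add (b4.const_mul (1 / 4)))).congr_deriv ?_
  norm_num
  ring

theorem truncf_eq {M : ℝ} (hM : 1 ≤ M) (u : ℝ) :
    truncf M u = u ^ 3 - u
      - (3 * M * max (u - M) 0 ^ 2 + max (u - M) 0 ^ 3)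
      + (3 * M * max (-u - M) 0 ^ 2 + max (-u - M) 0 ^ 3) :=
  (hasDerivAt_truncF hM u).deriv

theorem exists_hasDerivAt_truncf {M : ℝ} (hM : 1 ≤ M) (u : ℝ) :
    ∃ f' : ℝ, HasDerivAt (truncf M) f' u ∧ -1 ≤ f' ∧ f' ≤ 3 * M ^ 2 - 1 := by
  rw [show truncf M = _ from funext (truncf_eq hM)]
  have a1 : HasDerivAt (fun u : ℝ => u - M) 1 u := (hasDerivAt_id u).sub_const M
  have a2 : HasDerivAt (fun u : ℝ => -u - M) (-1) u := (hasDerivAt_id u).neg.sub_const M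
  have b1 := (hasDerivAt_max_zero_pow 0 (u - M)).comp u a1
  have b2 := (hasDerivAt_max_zero_pow 1 (u - M)).comp u a1
  have b3 := (hasDerivAt_max_zero_pow 0 (-u - M)).comp u a2
  have b4 := (hasDerivAt_max_zero_pow 1 (-u - M)).comp u a2
  have b0 : HasDerivAt (fun u : ℝ => u ^ 3 - u) (3 * u ^ 2 - 1) u := by
    exact ((hasDerivAt_pow 3 u).sub (hasDerivAt_id u)).congr_deriv (by norm_num)
  refine ⟨_, (b0.sub ((b1.const_mul (3 * M)).add b2)).add ((b3.const_mul (3 * M)).add b4), ?_⟩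
  norm_num
  rcases le_total M u with h | h
  · rw [max_eq_left (by linarith), max_eq_right (by linarith)]
    constructor <;> nlinarith
  rcases le_total u (-M) with h' | h'
  · rw [max_eq_right (by linarith), max_eq_left (by linarith)]
    constructor <;> nlinarith
  · rw [max_eq_right (by linarith), max_eq_right (by linarith)]
    constructor <;> nlinarith

theorem continuous_truncF {M : ℝ} (hM : 1 ≤ M) : Continuous (truncF M) :=
  continuous_iff_continuousAt.2 fun u => (hasDerivAt_truncF hM u).continuousAt

theorem hasDerivAt_truncF_truncf {M : ℝ} (hM : 1 ≤ M) (u : ℝ) :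
    HasDerivAt (truncF M) (truncf M u) u :=
  (hasDerivAt_truncF hM u).differentiableAt.hasDerivAt

theorem monotone_mul_sub_truncf {M : ℝ} (hM : 1 ≤ M) :
    Monotone fun u => (3 * M ^ 2 - 1) * u - truncf M u := by
  choose f' h1 h2 h3 using exists_hasDerivAt_truncf hM
  refine monotone_of_hasDerivAt_nonneg
    (fun u => ((hasDerivAt_id u).const_mul (3 * M ^ 2 - 1)).sub (h1 u)) fun u => ?_
  have := h3 u
  simpa using this

theorem monotone_mul_add_truncf {M : ℝ} (hM : 1 ≤ M) :
    Monotone fun u => (3 * M ^ 2 - 1) * u + truncf M u := by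
  choose f' h1 h2 h3 using exists_hasDerivAt_truncf hM
  refine monotone_of_hasDerivAt_nonneg
    (fun u => ((hasDerivAt_id u).const_mul (3 * M ^ 2 - 1)).add (h1 u)) fun u => ?_
  have := h2 u
  simp only [mul_one, Pi.zero_apply]
  nlinarith

theorem abs_truncf_sub_le {M : ℝ} (hM : 1 ≤ M) (x y : ℝ) :
    |truncf M x - truncf M y| ≤ (3 * M ^ 2 - 1) * |x - y| := by
  wlog h : y ≤ x generalizing x y
  · rw [abs_sub_comm, abs_sub_comm x]
    exact this y x (le_of_not_ge h)
  have h1 := monotone_mul_sub_truncf hM h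
  have h2 := monotone_mul_add_truncf hM h
  simp only at h1 h2
  rw [abs_of_nonneg (sub_nonneg.2 h), abs_le]
  constructor <;> linarith

/-- The quadratic upper bound for the potential. -/
theorem truncF_sub_le {M : ℝ} (hM : 1 ≤ M) (x y : ℝ) :
    truncF M y - truncF M x ≤ truncf M x * (y - x) + (3 * M ^ 2 - 1) / 2 * (y - x) ^ 2 := by
  have hd : ∀ u : ℝ, HasDerivAt (fun u => (3 * M ^ 2 - 1) / 2 * u ^ 2 - truncF M u)
      ((3 * M ^ 2 - 1) * u - truncf M u) u := fun u => by
    refine (((hasDerivAt_pow 2 u).const_mul ((3 * M ^ 2 - 1) / 2)).sub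
      (hasDerivAt_truncF_truncf hM u)).congr_deriv ?_
    norm_num
    ring
  have hconv : ConvexOn ℝ Set.univ fun u => (3 * M ^ 2 - 1) / 2 * u ^ 2 - truncF M u := by
    apply Monotone.convexOn_univ_of_deriv fun u => (hd u).differentiableAt
    rw [show deriv (fun u => (3 * M ^ 2 - 1) / 2 * u ^ 2 - truncF M u) = _ from
      funext fun u => (hd u).deriv]
    exact monotone_mul_sub_truncf hM
  rcases lt_trichotomy x y with h | rfl | h
  · have := hconv.le_slope_of_hasDerivAt (Set.mem_univ x) (Set.mem_univ y) h (hd x)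
    rw [slope_def_field, le_div_iff₀ (by linarith)] at this
    nlinarith
  · simp
  · have := hconv.slope_le_of_hasDerivAt (Set.mem_univ y) (Set.mem_univ x) h (hd x)
    rw [slope_def_field, div_le_iff₀ (by linarith)] at this
    nlinarith

theorem truncF_nonneg {M : ℝ} (hM : 1 ≤ M) (u : ℝ) : 0 ≤ truncF M u := by
  have hL : 0 ≤ 3 * M ^ 2 - 1 := by nlinarith
  have hM3 : 0 ≤ M ^ 3 - M := by nlinarith [mul_nonneg (by linarith : 0 ≤ M) (by nlinarith : 0 ≤ M ^ 2 - 1)]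
  unfold truncF
  split_ifs with h1 h2
  · have := mul_nonneg hM3 (sub_nonneg.2 h1)
    positivity
  · have := mul_nonneg hM3 (by linarith : 0 ≤ -(u + M))
    have := mul_nonneg hL (sq_nonneg (u + M))
    nlinarith [sq_nonneg (M ^ 2 - 1)]
  · positivity

/-- Quadratic growth makes the potential of an L² function integrable on a set of finite measure. -/
theorem norm_truncF_le {M : ℝ} (hM : 1 ≤ M) (u : ℝ) :
    ‖truncF M u‖ ≤ 1 / 4 + (3 * M ^ 2 - 1) / 2 * u ^ 2 := by
  rw [Real.norm_of_nonneg (truncF_nonneg hM u)]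
  have h := truncF_sub_le hM 0 u
  have h0 : truncF M 0 = 1 / 4 := by
    rw [truncF, if_neg (by linarith), if_neg (by linarith)]
    norm_num
  have h1 : truncf M 0 = 0 := by
    rw [truncf_eq hM]
    simp
  rw [h0, h1] at h
  simpa [sub_le_iff_le_add, add_comm] using h

/-! ### The discrete fractional derivative -/

theorem coefD_add_two (α : ℝ) (k : ℕ) : coefD α (k + 2) = coefC α (k + 2) - coefA α (k + 1) := by
  rw [coefD, if_neg (by lia), show k + 2 - 1 = k + 1 by lia]

theorem coefB_eq (α : ℝ) (j : ℕ) : coefB α j = -coefA α j - coefC α j := by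
  unfold coefA coefB coefC
  ring

theorem sum_Icc_one_eq_sum_range (f : ℕ → ℝ) (m : ℕ) :
    ∑ j ∈ Finset.Icc 1 m, f j = ∑ i ∈ Finset.range m, f (i + 1) := by
  rw [Finset.range_eq_Ico, Finset.sum_Ico_add' f 0 m 1]
  rfl

/-- Summation by parts. -/
theorem sum_mul_forward_diff (D v : ℕ → ℝ) (m : ℕ) :
    ∑ i ∈ Finset.range (m + 1), D (m + 1 - i) * (v (i + 2) - v (i + 1)) =
      ∑ i ∈ Finset.range (m + 1), (D (m + 1 - i) - D (m + 2 - i)) * (v (m + 2) - v (i + 1))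
        + D (m + 2) * (v (m + 2) - v 1) := by
  have h1 : ∑ i ∈ Finset.range (m + 1), D (m + 1 - i) * (v (m + 2) - v (i + 2)) =
      ∑ i ∈ Finset.range m, D (m + 1 - i) * (v (m + 2) - v (i + 2)) := by
    rw [Finset.sum_range_succ]
    simp
  have h2 : ∑ i ∈ Finset.range (m + 1), D (m + 2 - i) * (v (m + 2) - v (i + 1)) =
      ∑ i ∈ Finset.range m, D (m + 1 - i) * (v (m + 2) - v (i + 2))
        + D (m + 2) * (v (m + 2) - v 1) := by
    rw [Finset.sum_range_succ']
    simp only [Nat.sub_zero, zero_add]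
    congr 1
    refine Finset.sum_congr rfl fun i _ => ?_
    rw [show m + 2 - (i + 1) = m + 1 - i by lia]
  have h3 : ∑ i ∈ Finset.range (m + 1), D (m + 1 - i) * (v (i + 2) - v (i + 1)) =
      ∑ i ∈ Finset.range (m + 1), D (m + 1 - i) * (v (m + 2) - v (i + 1)) -
        ∑ i ∈ Finset.range (m + 1), D (m + 1 - i) * (v (m + 2) - v (i + 2)) := by
    rw [← Finset.sum_sub_distrib]
    exact Finset.sum_congr rfl fun i _ => by ring
  simp only [sub_mul (D _), Finset.sum_sub_distrib]
  linarith

/-- Since a_j + b_j + c_j = 0, each bracket is a combination of two consecutive increments. An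
interior increment collects c_j from one bracket and -a_{j-1} from its neighbour, which is d_j; the
newest one lacks the 2 - 2α contained in d₁, hence the correction. -/
theorem sum_coef_mul (α : ℝ) (v : ℕ → ℝ) (m : ℕ) :
    ∑ j ∈ Finset.range (m + 1), (coefA α (j + 1) * v (m - j) + coefB α (j + 1) * v (m + 1 - j)
        + coefC α (j + 1) * v (m + 1 - j + 1)) =
      ∑ i ∈ Finset.range (m + 1), coefD α (m + 1 - i) * (v (i + 2) - v (i + 1))
        - (2 - 2 * α) * (v (m + 2) - v (m + 1)) - coefA α (m + 1) * (v 1 - v 0) := by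
  have h1 : ∑ j ∈ Finset.range (m + 1),
        (coefA α (j + 1) * v (m - j) + coefB α (j + 1) * v (m + 1 - j)
          + coefC α (j + 1) * v (m + 1 - j + 1)) =
      ∑ i ∈ Finset.range (m + 1), coefC α (m + 1 - i) * (v (i + 2) - v (i + 1))
        - ∑ i ∈ Finset.range (m + 1), coefA α (m + 1 - i) * (v (i + 1) - v i) := by
    rw [← Finset.sum_range_reflect, ← Finset.sum_sub_distrib]
    refine Finset.sum_congr rfl fun i hi => ?_
    rw [Finset.mem_range] at hi
    rw [show m + 1 - 1 - i + 1 = m + 1 - i by lia, show m - (m + 1 - 1 - i) = i by lia,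
      show m + 1 - (m + 1 - 1 - i) = i + 1 by lia, coefB_eq]
    ring
  rw [h1, Finset.sum_range_succ (fun i => coefC α (m + 1 - i) * _),
    Finset.sum_range_succ' (fun i => coefA α (m + 1 - i) * _),
    Finset.sum_range_succ (fun i => coefD α (m + 1 - i) * _)]
  have h2 : ∑ i ∈ Finset.range m, coefD α (m + 1 - i) * (v (i + 2) - v (i + 1)) =
      ∑ i ∈ Finset.range m, coefC α (m + 1 - i) * (v (i + 2) - v (i + 1)) -
        ∑ i ∈ Finset.range m, coefA α (m + 1 - (i + 1)) * (v (i + 1 + 1) - v (i + 1)) := by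
    rw [← Finset.sum_sub_distrib]
    refine Finset.sum_congr rfl fun i hi => ?_
    rw [Finset.mem_range] at hi
    obtain ⟨k, rfl⟩ : ∃ k, m = i + 1 + k := ⟨m - (i + 1), by lia⟩
    rw [show i + 1 + k + 1 - i = k + 2 by lia, show i + 1 + k + 1 - (i + 1) = k + 1 by lia,
      coefD_add_two]
    ring
  have h3 : coefD α 1 = coefC α 1 + 2 - 2 * α := by rw [coefD, if_pos rfl]
  simp only [show m + 1 - m = 1 by lia, Nat.sub_zero, zero_add, h2, h3]
  ring

/-- The factor 3α/2 is (4 - α)/2 - (2 - 2α). Splitting d_n = c_n - a_{n-1} merges the increments to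
v 1 and v 0 into the last two terms. -/
theorem L2Caputo_eq (α τ : ℝ) (v : ℕ → ℝ) (m : ℕ) :
    L2Caputo α τ v (m + 2) = 1 / (Real.Gamma (3 - α) * τ ^ α) *
      (3 * α / 2 * (v (m + 2) - v (m + 1)) - α / 2 * (v (m + 1) - v m)
        + ∑ i ∈ Finset.range (m + 1),
          (coefD α (m + 1 - i) - coefD α (m + 2 - i)) * (v (m + 2) - v (i + 1))
        + coefC α (m + 2) * (v (m + 2) - v 1) - coefA α (m + 1) * (v (m + 2) - v 0)) := by
  have h := sum_coef_mul α v m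
  rw [sum_mul_forward_diff, coefD_add_two] at h
  rw [L2Caputo, show m + 2 - 1 = m + 1 by lia, sum_Icc_one_eq_sum_range]
  simp only [show ∀ i, m + 2 - (i + 1) = m + 1 - i by lia,
    show ∀ i, m + 1 - i - 1 = m - i by lia, Nat.add_sub_cancel, h]
  ring

/-- The nonlocal term of a scalar sequence. -/
noncomputable def scalarNonlocal (α : ℝ) (v : ℕ → ℝ) (n : ℕ) : ℝ :=
  α / 4 * (v n - v (n - 1)) ^ 2
    + 1 / 2 * ∑ j ∈ Finset.Icc 1 (n - 1),
        (coefD α (n - j) - coefD α (n - j + 1)) * (v n - v j) ^ 2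
    + coefC α n / 2 * (v n - v 1) ^ 2 - coefA α n / 2 * (v n - v 0) ^ 2

theorem scalarNonlocal_sub_le {α : ℝ} (hα0 : 0 < α) (hα1 : α < 1) (v : ℕ → ℝ) (m : ℕ) :
    scalarNonlocal α v (m + 2) - scalarNonlocal α v (m + 1)
        + α * (v (m + 2) - v (m + 1)) ^ 2 ≤
      (3 * α / 2 * (v (m + 2) - v (m + 1)) - α / 2 * (v (m + 1) - v m)
        + ∑ i ∈ Finset.range (m + 1),
          (coefD α (m + 1 - i) - coefD α (m + 2 - i)) * (v (m + 2) - v (i + 1))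
        + coefC α (m + 2) * (v (m + 2) - v 1) - coefA α (m + 1) * (v (m + 2) - v 0))
        * (v (m + 2) - v (m + 1)) := by
  have htel : ∑ i ∈ Finset.range (m + 1), (coefD α (m + 1 - i) - coefD α (m + 2 - i)) =
      coefD α 1 - coefD α (m + 2) := by
    have := Finset.sum_range_sub (fun i => coefD α (m + 2 - i)) (m + 1)
    simpa [show ∀ i, m + 2 - (i + 1) = m + 1 - i by lia] using this
  have hpol : (∑ i ∈ Finset.range (m + 1),
      (coefD α (m + 1 - i) - coefD α (m + 2 - i)) * (v (m + 2) - v (i + 1)))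
        * (v (m + 2) - v (m + 1)) =
      1 / 2 * ∑ i ∈ Finset.range (m + 1),
        (coefD α (m + 1 - i) - coefD α (m + 2 - i)) * (v (m + 2) - v (i + 1)) ^ 2
      - 1 / 2 * ∑ i ∈ Finset.range (m + 1),
        (coefD α (m + 1 - i) - coefD α (m + 2 - i)) * (v (m + 1) - v (i + 1)) ^ 2
      + 1 / 2 * (coefD α 1 - coefD α (m + 2)) * (v (m + 2) - v (m + 1)) ^ 2 := by
    rw [← htel, Finset.sum_mul, Finset.mul_sum, Finset.mul_sum, Finset.mul_sum, Finset.sum_mul,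
      ← Finset.sum_sub_distrib, ← Finset.sum_add_distrib]
    exact Finset.sum_congr rfl fun i _ => by ring
  have hmono : ∑ i ∈ Finset.range (m + 1),
        (coefD α (m + 1 - i) - coefD α (m + 2 - i)) * (v (m + 1) - v (i + 1)) ^ 2 ≤
      ∑ i ∈ Finset.range m,
        (coefD α (m - i) - coefD α (m + 1 - i)) * (v (m + 1) - v (i + 1)) ^ 2 := by
    -- The term i = m carries (v (m+1) - v (m+1))² and vanishes; convexity of d_j compares the
    -- others one by one.
    rw [Finset.sum_range_succ, sub_self, zero_pow two_ne_zero, mul_zero, add_zero]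
    refine Finset.sum_le_sum fun i hi => ?_
    rw [Finset.mem_range] at hi
    obtain ⟨k, rfl⟩ : ∃ k, m = i + 1 + k := ⟨m - (i + 1), by lia⟩
    have := coefD_secondDiff_nonneg hα0 hα1 (show 1 ≤ k + 1 by lia)
    rw [show i + 1 + k - i = k + 1 by lia, show i + 1 + k + 1 - i = k + 1 + 1 by lia,
      show i + 1 + k + 2 - i = k + 1 + 2 by lia]
    exact mul_le_mul_of_nonneg_right (by linarith) (sq_nonneg _)
  have hA := mul_nonneg (sub_nonneg.2 (coefA_le_succ hα0 hα1 (show 1 ≤ m + 1 by lia)))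
    (sq_nonneg (v (m + 2) - v 0))
  have hC := mul_nonneg (sub_nonneg.2 (coefC_succ_le hα0 hα1 (show 1 ≤ m + 1 by lia)))
    (sq_nonneg (v (m + 1) - v 1))
  -- With n = m + 2, the squares of δₙ produced by polarization have total coefficient (d₁ - d_n +
  -- c_n - a_{n-1})/2 = d₁/2.
  have hD := mul_nonneg (coefD_one_nonneg hα0 hα1) (sq_nonneg (v (m + 2) - v (m + 1)))
  -- Young's inequality for the local terms: 3α/2 δₙ² - α/2 δₙ δₙ₋₁ ≥ α δₙ² + α/4 (δₙ² - δₙ₋₁²).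
  have hcross := mul_nonneg hα0.le (sq_nonneg ((v (m + 2) - v (m + 1)) - (v (m + 1) - v m)))
  have hDn := coefD_add_two α m
  have e1 : scalarNonlocal α v (m + 2) = α / 4 * (v (m + 2) - v (m + 1)) ^ 2
      + 1 / 2 * ∑ i ∈ Finset.range (m + 1),
        (coefD α (m + 1 - i) - coefD α (m + 2 - i)) * (v (m + 2) - v (i + 1)) ^ 2
      + coefC α (m + 2) / 2 * (v (m + 2) - v 1) ^ 2
      - coefA α (m + 2) / 2 * (v (m + 2) - v 0) ^ 2 := by
    rw [scalarNonlocal, show m + 2 - 1 = m + 1 by lia, sum_Icc_one_eq_sum_range]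
    congr 4
    refine Finset.sum_congr rfl fun i hi => ?_
    rw [Finset.mem_range] at hi
    rw [show m + 2 - (i + 1) + 1 = m + 2 - i by lia, show m + 2 - (i + 1) = m + 1 - i by lia]
  have e2 : scalarNonlocal α v (m + 1) = α / 4 * (v (m + 1) - v m) ^ 2
      + 1 / 2 * ∑ i ∈ Finset.range m,
        (coefD α (m - i) - coefD α (m + 1 - i)) * (v (m + 1) - v (i + 1)) ^ 2
      + coefC α (m + 1) / 2 * (v (m + 1) - v 1) ^ 2
      - coefA α (m + 1) / 2 * (v (m + 1) - v 0) ^ 2 := by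
    rw [scalarNonlocal, show m + 1 - 1 = m by lia, sum_Icc_one_eq_sum_range]
    congr 4
    refine Finset.sum_congr rfl fun i hi => ?_
    rw [Finset.mem_range] at hi
    rw [show m + 1 - (i + 1) + 1 = m + 1 - i by lia, show m + 1 - (i + 1) = m - i by lia]
  rw [e1, e2, sub_mul, add_mul, add_mul, hpol, hDn]
  linarith

/-- The stabilization dominates the explicit treatment of the nonlinearity for every step size. -/
theorem stabilization_le {α γ S τ Γ L : ℝ} (hα0 : 0 < α) (hα1 : α < 1) (hγ : 0 < γ) (hτ : 0 < τ)
    (hΓ : 0 < Γ) (hL : 0 < L)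
    (hS : 3 * α * L / (2 * (1 + α)) * (3 * γ * Γ * L / (2 * α * (1 + α))) ^ (1 / α) ≤ S) :
    3 * L / 2 ≤ 1 / γ * (1 / (Γ * τ ^ α) * α) + S * τ := by
  set R := 3 * γ * Γ * L / (2 * α * (1 + α)) with hR
  have hR0 : 0 < R := by positivity
  -- In the rescaled step y, with B = 3L/(2(1+α)), the claim follows from B (1 + α) ≤ B (y^(-α) + α
  -- y). The right side is minimal at y = 1, with equality there, which is where the threshold for S
  -- comes from.
  set y := τ * R ^ (1 / α) with hy
  have hy0 : 0 < y := by positivity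
  have hyα : y ^ α = τ ^ α * R := by
    rw [hy, Real.mul_rpow hτ.le (by positivity), ← Real.rpow_mul hR0.le, one_div_mul_cancel hα0.ne',
      Real.rpow_one]
  have hbern : y ^ α ≤ 1 + α * (y - 1) := by
    have := rpow_one_add_le_one_add_mul_self (s := y - 1) (p := α) (by linarith) hα0.le hα1.le
    simpa using this
  have hinv : 1 - α * (y - 1) ≤ (y ^ α)⁻¹ := by
    have hpos : 0 < y ^ α := by positivity
    have h2 : 2 - y ^ α ≤ (y ^ α)⁻¹ := by
      rw [inv_eq_one_div, le_div_iff₀ hpos]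
      nlinarith [sq_nonneg (y ^ α - 1)]
    linarith
  have hB : 0 < 3 * L / (2 * (1 + α)) := by positivity
  have e1 : 1 / γ * (1 / (Γ * τ ^ α) * α) = 3 * L / (2 * (1 + α)) * (y ^ α)⁻¹ := by
    have : 0 < τ ^ α := by positivity
    rw [hyα, hR]
    field_simp
  have e2 : 3 * L / (2 * (1 + α)) * (α * y) ≤ S * τ := by
    refine le_trans (le_of_eq ?_) (mul_le_mul_of_nonneg_right hS hτ.le)
    rw [hy]
    ring
  have e3 : 3 * L / 2 = 3 * L / (2 * (1 + α)) * (1 + α) := by field_simp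
  have e4 := mul_le_mul_of_nonneg_left hinv hB.le
  rw [e1, e3]
  linarith

/-- Here `w` stands for the value of the Laplacian at one point; its product with the increment is
kept untouched for the integration by parts. -/
theorem pointwise_energy_le {α γ ε M S τ w : ℝ} (hα0 : 0 < α) (hα1 : α < 1) (hγ : 0 < γ)
    (hM : 1 ≤ M) (hτ : 0 < τ)
    (hS : 3 * α * (3 * M ^ 2 - 1) / (2 * (1 + α)) *
      (3 * γ * Real.Gamma (3 - α) * (3 * M ^ 2 - 1) / (2 * α * (1 + α))) ^ (1 / α) ≤ S)
    (v : ℕ → ℝ) (m : ℕ)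
    (h : L2Caputo α τ v (m + 2) =
        γ * (ε ^ 2 * w - 2 * truncf M (v (m + 1)) + truncf M (v m)
          - S * τ * (v (m + 2) - v (m + 1)))) :
    truncF M (v (m + 2))
        + 1 / γ * (1 / (Real.Gamma (3 - α) * τ ^ α) * scalarNonlocal α v (m + 2))
        + 1 / 2 * (3 * M ^ 2 - 1) * (v (m + 2) - v (m + 1)) ^ 2 ≤
      truncF M (v (m + 1))
        + 1 / γ * (1 / (Real.Gamma (3 - α) * τ ^ α) * scalarNonlocal α v (m + 1))
        + 1 / 2 * (3 * M ^ 2 - 1) * (v (m + 1) - v m) ^ 2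
        + ε ^ 2 * (w * v (m + 2) - w * v (m + 1)) := by
  have hL : 0 < 3 * M ^ 2 - 1 := by nlinarith
  have hΓ : 0 < Real.Gamma (3 - α) := Real.Gamma_pos_of_pos (by linarith)
  have hstab := mul_le_mul_of_nonneg_right (stabilization_le hα0 hα1 hγ hτ hΓ hL hS)
    (sq_nonneg (v (m + 2) - v (m + 1)))
  have hF := truncF_sub_le hM (v (m + 1)) (v (m + 2))
  -- The extrapolation 2f̃(uⁿ⁻¹) - f̃(uⁿ⁻²) is f̃(uⁿ⁻¹) plus this lagged difference. Its δₙ₋₁² part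
  -- is absorbed by the extra term of the previous modified energy.
  have hf : -(truncf M (v (m + 1)) - truncf M (v m)) * (v (m + 2) - v (m + 1)) ≤
      (3 * M ^ 2 - 1) / 2 * ((v (m + 2) - v (m + 1)) ^ 2 + (v (m + 1) - v m) ^ 2) := by
    have h1 := abs_truncf_sub_le hM (v (m + 1)) (v m)
    have h2 := mul_le_mul_of_nonneg_right h1 (abs_nonneg (v (m + 2) - v (m + 1)))
    rw [← abs_mul] at h2
    have h3 := neg_abs_le ((truncf M (v (m + 1)) - truncf M (v m)) * (v (m + 2) - v (m + 1)))
    have h4 := mul_nonneg hL.le (sq_nonneg (|v (m + 1) - v m| - |v (m + 2) - v (m + 1)|))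
    rw [sub_sq, sq_abs, sq_abs] at h4
    linarith
  have hK : 0 < 1 / (Real.Gamma (3 - α) * τ ^ α) := by positivity
  rw [L2Caputo_eq] at h
  have hD := mul_le_mul_of_nonneg_left (scalarNonlocal_sub_le hα0 hα1 v m)
    (mul_nonneg (one_div_pos.2 hγ).le hK.le)
  rw [mul_assoc (1 / γ), mul_assoc (1 / γ), ← mul_assoc (1 / (Real.Gamma (3 - α) * τ ^ α)), h,
    mul_assoc γ, ← mul_assoc (1 / γ) γ, one_div_mul_cancel hγ.ne', one_mul] at hD
  linarith

/-! ### Integration of the pointwise estimate -/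

theorem eLpNorm_inner_le {X E : Type*} [MeasurableSpace X] {μ : Measure X}
    [NormedAddCommGroup E] [InnerProductSpace ℝ E] {f g : X → E}
    (hf : AEStronglyMeasurable f μ) (hg : AEStronglyMeasurable g μ) :
    eLpNorm (fun x => inner ℝ (f x) (g x)) 1 μ ≤ eLpNorm f 2 μ * eLpNorm g 2 μ := by
  simpa using eLpNorm_le_eLpNorm_mul_eLpNorm'_of_norm (p := 2) (q := 2) (r := 1) hf hg
    (fun a b : E => inner ℝ a b) 1 (Eventually.of_forall fun x => by
      simpa using norm_inner_le_norm (𝕜 := ℝ) (f x) (g x))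

theorem integrable_inner_of_memLp {X E : Type*} [MeasurableSpace X] {μ : Measure X}
    [NormedAddCommGroup E] [InnerProductSpace ℝ E] {f g : X → E}
    (hf : MemLp f 2 μ) (hg : MemLp g 2 μ) : Integrable (fun x => inner ℝ (f x) (g x)) μ :=
  memLp_one_iff_integrable.1 ⟨hf.1.inner hg.1,
    (eLpNorm_inner_le hf.1 hg.1).trans_lt (ENNReal.mul_lt_top hf.2 hg.2)⟩

theorem tendsto_integral_inner_of_eLpNorm {X E : Type*} [MeasurableSpace X] {μ : Measure X}
    [NormedAddCommGroup E] [InnerProductSpace ℝ E] {f g : X → E} {φ : ℕ → X → E}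
    (hf : MemLp f 2 μ) (hg : MemLp g 2 μ) (hφ : ∀ k, AEStronglyMeasurable (φ k) μ)
    (h : Tendsto (fun k => eLpNorm (fun x => φ k x - g x) 2 μ) atTop (𝓝 0)) :
    Tendsto (fun k => ∫ x, inner ℝ (f x) (φ k x) ∂μ) atTop (𝓝 (∫ x, inner ℝ (f x) (g x) ∂μ)) := by
  -- The φ k are not assumed square integrable; convergence makes the differences so for large k.
  have hev : ∀ᶠ k in atTop, MemLp (fun x => φ k x - g x) 2 μ := by
    filter_upwards [h.eventually_lt_const ENNReal.zero_lt_top] with k hk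
    exact ⟨(hφ k).sub hg.1, hk⟩
  have hnorm : Tendsto (fun k => (eLpNorm f 2 μ * eLpNorm (fun x => φ k x - g x) 2 μ).toReal)
      atTop (𝓝 0) := by
    have h1 := ENNReal.Tendsto.const_mul h (Or.inr hf.2.ne)
    rw [mul_zero] at h1
    exact (ENNReal.tendsto_toReal ENNReal.zero_ne_top).comp h1
  rw [tendsto_iff_norm_sub_tendsto_zero]
  refine squeeze_zero' (Eventually.of_forall fun _ => norm_nonneg _) ?_ hnorm
  filter_upwards [hev] with k hk
  have i1 : Integrable (fun x => inner ℝ (f x) (φ k x - g x)) μ := integrable_inner_of_memLp hf hk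
  have i2 : Integrable (fun x => inner ℝ (f x) (g x)) μ := integrable_inner_of_memLp hf hg
  have i3 : Integrable (fun x => inner ℝ (f x) (φ k x)) μ := by
    refine (i1.add i2).congr (Eventually.of_forall fun x => ?_)
    simp [inner_sub_right]
  rw [← integral_sub i3 i2]
  simp only [← inner_sub_right]
  rw [← toReal_enorm]
  refine ENNReal.toReal_mono (ENNReal.mul_lt_top hf.2 hk.2).ne ?_
  refine (enorm_integral_le_lintegral_enorm _).trans ?_
  rw [← eLpNorm_one_eq_lintegral_enorm]
  exact eLpNorm_inner_le hf.1 hk.1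

theorem gradient_continuous {d : ℕ} {φ : EuclideanSpace ℝ (Fin d) → ℝ} (h : ContDiff ℝ ∞ φ) :
    Continuous (gradient φ) :=
  (LinearIsometryEquiv.continuous _).comp (h.continuous_fderiv (by simp))

/-- Green's formula for the weak Laplacian, tested with elements of the energy space. -/
theorem IsLaplacian.integral_mul_eq {d : ℕ} {Ω : Set (EuclideanSpace ℝ (Fin d))}
    {bc : BoundaryCondition d} {u : H1 Ω} {w : EuclideanSpace ℝ (Fin d) → ℝ}
    (h : IsLaplacian bc u w) {v : H1 Ω} (hv : bc.EnergySpace v) :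
    ∫ x in Ω, w x * v x = - ∫ x in Ω, inner ℝ (u.grad x) (v.grad x) := by
  -- Both sides are continuous in `v` for the H¹ norm, so the identity passes from smooth test
  -- functions to their closure.
  have closure_case : ∀ T : (EuclideanSpace ℝ (Fin d) → ℝ) → Prop,
      (∀ φ, T φ → ContDiff ℝ ∞ φ) →
      (∀ φ, T φ → ∫ x in Ω, w x * φ x = - ∫ x in Ω, inner ℝ (u.grad x) (gradient φ x)) →
      InClosure T v → ∫ x in Ω, w x * v x = - ∫ x in Ω, inner ℝ (u.grad x) (v.grad x) := by
    rintro T hT hw ⟨φ, hφ, h1, h2⟩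
    have t1 := tendsto_integral_inner_of_eLpNorm h.1 v.memLp_toFun
      (fun k => (hT _ (hφ k)).continuous.aestronglyMeasurable) h1
    have t2 := tendsto_integral_inner_of_eLpNorm u.memLp_grad v.memLp_grad
      (fun k => (gradient_continuous (hT _ (hφ k))).aestronglyMeasurable) h2
    have e : ∀ a b : ℝ, inner ℝ a b = a * b := fun a b => by simp [mul_comm]
    simp only [e] at t1
    refine tendsto_nhds_unique t1 ?_
    simpa only [hw _ (hφ _)] using t2.neg
  obtain ⟨hw, hu, h⟩ := h
  cases bc with
  | dirichlet => exact closure_case _ (fun φ hφ => hφ.1) h hv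
  | neumann => exact h v
  | periodic ℓ => exact closure_case _ (fun φ hφ => hφ.1) h hv

theorem integrable_truncF_comp {X : Type*} [MeasurableSpace X] {μ : Measure X} [IsFiniteMeasure μ]
    {M : ℝ} (hM : 1 ≤ M) {f : X → ℝ} (hf : MemLp f 2 μ) :
    Integrable (fun x => truncF M (f x)) μ :=
  ((integrable_const (1 / 4)).add (hf.integrable_sq.const_mul ((3 * M ^ 2 - 1) / 2))).mono'
    ((continuous_truncF hM).comp_aestronglyMeasurable hf.1)
    (Eventually.of_forall fun x => norm_truncF_le hM (f x))

/-! ### Integrated form of the modified energy and its decay. -/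

section

variable {d : ℕ} {Ω : Set (EuclideanSpace ℝ (Fin d))}

theorem integrable_sub_sq (u v : H1 Ω) :
    Integrable (fun x => (u x - v x) ^ 2) (volume.restrict Ω) :=
  (u.memLp_toFun.sub v.memLp_toFun).integrable_sq

theorem integrable_scalarNonlocal (α : ℝ) (u : ℕ → H1 Ω) (n : ℕ) :
    Integrable (fun x => scalarNonlocal α (fun k => u k x) n) (volume.restrict Ω) :=
  ((((integrable_sub_sq _ _).const_mul _).add ((integrable_finsetSum _ fun _ _ =>
    (integrable_sub_sq _ _).const_mul _).const_mul _)).add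
      ((integrable_sub_sq _ _).const_mul _)).sub ((integrable_sub_sq _ _).const_mul _)

theorem nonlocalTerm_eq_integral (α τ : ℝ) (u : ℕ → H1 Ω) (n : ℕ) :
    nonlocalTerm α τ u n = 1 / (Real.Gamma (3 - α) * τ ^ α) *
      ∫ x in Ω, scalarNonlocal α (fun k => u k x) n := by
  have i := fun (c : ℝ) (j k : ℕ) => (integrable_sub_sq (u j) (u k)).const_mul c
  have is := (integrable_finsetSum (Finset.Icc 1 (n - 1)) fun j _ =>
    i (coefD α (n - j) - coefD α (n - j + 1)) n j).const_mul (1 / 2)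
  unfold scalarNonlocal nonlocalTerm distSq
  rw [integral_sub (((i _ _ _).fun_add is).fun_add (i _ _ _)) (i _ _ _),
    integral_add ((i _ _ _).fun_add is) (i _ _ _), integral_add (i _ _ _) is]
  simp only [integral_const_mul]
  rw [integral_finsetSum _ fun j _ => i _ _ _]
  simp only [integral_const_mul]

theorem modifiedEnergy_eq_integral [IsFiniteMeasure (volume.restrict Ω)] (α γ ε τ : ℝ) {M : ℝ}
    (hM : 1 ≤ M) (u : ℕ → H1 Ω) (n : ℕ) :
    modifiedEnergy α γ ε M τ u n =
      ε ^ 2 / 2 * (∫ x in Ω, ‖(u n).grad x‖ ^ 2)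
      + ∫ x in Ω, (truncF M (u n x)
        + 1 / γ * (1 / (Real.Gamma (3 - α) * τ ^ α) * scalarNonlocal α (fun k => u k x) n)
        + 1 / 2 * (3 * M ^ 2 - 1) * (u n x - u (n - 1) x) ^ 2) := by
  have i1 := integrable_truncF_comp hM (u n).memLp_toFun
  have i2 := ((integrable_scalarNonlocal α u n).const_mul
    (1 / (Real.Gamma (3 - α) * τ ^ α))).const_mul (1 / γ)
  have i3 := (integrable_sub_sq (u n) (u (n - 1))).const_mul (1 / 2 * (3 * M ^ 2 - 1))
  have i0 := (u n).memLp_grad.integrable_norm_pow two_ne_zero |>.const_mul (ε ^ 2 / 2)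
  unfold modifiedEnergy energy
  rw [nonlocalTerm_eq_integral, distSq, integral_add (i1.fun_add i2) i3, integral_add i1 i2,
    integral_add i0 i1]
  simp only [integral_const_mul]
  ring

theorem SchemeStep.modifiedEnergy_le [IsFiniteMeasure (volume.restrict Ω)]
    {bc : BoundaryCondition d} {α γ ε M S τ : ℝ} (hα0 : 0 < α) (hα1 : α < 1) (hγ : 0 < γ)
    (hM : 1 ≤ M) (hτ : 0 < τ)
    (hS : 3 * α * (3 * M ^ 2 - 1) / (2 * (1 + α)) *
      (3 * γ * Real.Gamma (3 - α) * (3 * M ^ 2 - 1) / (2 * α * (1 + α))) ^ (1 / α) ≤ S)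
    {u : ℕ → H1 Ω} {m : ℕ} (hu : bc.EnergySpace (u (m + 1)))
    (h : SchemeStep bc α γ ε M S τ u (m + 2)) :
    modifiedEnergy α γ ε M τ u (m + 2) ≤ modifiedEnergy α γ ε M τ u (m + 1) := by
  obtain ⟨w, hw, h⟩ := h
  have g2 := hw.integral_mul_eq hw.2.1
  have g1 := hw.integral_mul_eq hu
  have j : ∀ n, Integrable (fun x => truncF M (u n x)
        + 1 / γ * (1 / (Real.Gamma (3 - α) * τ ^ α) * scalarNonlocal α (fun k => u k x) n)
        + 1 / 2 * (3 * M ^ 2 - 1) * (u n x - u (n - 1) x) ^ 2) (volume.restrict Ω) := fun n =>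
    ((integrable_truncF_comp hM (u n).memLp_toFun).add
      (((integrable_scalarNonlocal α u n).const_mul _).const_mul _)).add
      ((integrable_sub_sq (u n) (u (n - 1))).const_mul _)
  have jw : ∀ n, Integrable (fun x => w x * u n x) (volume.restrict Ω) := fun n =>
    hw.1.integrable_mul (u n).memLp_toFun
  have jw' : Integrable (fun x => ε ^ 2 * (w x * u (m + 2) x - w x * u (m + 1) x))
      (volume.restrict Ω) := ((jw (m + 2)).sub (jw (m + 1))).const_mul (ε ^ 2)
  have hle := integral_mono_ae (j (m + 2)) ((j (m + 1)).add jw') (by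
    filter_upwards [h] with x hx
    exact pointwise_energy_le hα0 hα1 hγ hM hτ hS (fun k => u k x) m hx)
  simp only [Pi.add_apply] at hle
  rw [integral_add (j (m + 1)) jw', integral_const_mul] at hle
  rw [integral_sub (jw _) (jw _), g1, g2] at hle
  have k : ∀ n, Integrable (fun x => ‖(u n).grad x‖ ^ 2) (volume.restrict Ω) := fun n =>
    (u n).memLp_grad.integrable_norm_pow two_ne_zero
  have k' : ∀ n, Integrable (fun x => inner ℝ ((u (m + 2)).grad x) ((u n).grad x))
      (volume.restrict Ω) := fun n => 
    integrable_inner_of_memLp (u (m + 2)).memLp_grad (u n).memLp_grad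
  -- Combined with Green's formula for uⁿ and uⁿ⁻¹, this bounds the Laplacian term by ε²/2 (‖∇uⁿ⁻¹‖²
  -- - ‖∇uⁿ‖²).
  have hgrad : ∫ x in Ω, inner ℝ ((u (m + 2)).grad x) ((u (m + 1)).grad x) ≤
      1 / 2 * (∫ x in Ω, ‖(u (m + 2)).grad x‖ ^ 2) + 1 / 2 * ∫ x in Ω, ‖(u (m + 1)).grad x‖ ^ 2 := by
    rw [← integral_const_mul, ← integral_const_mul,
      ← integral_add ((k _).const_mul _) ((k _).const_mul _)]
    refine integral_mono (k' _) (((k _).const_mul _).add ((k _).const_mul _)) fun x => ?_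
    have := real_inner_le_norm ((u (m + 2)).grad x) ((u (m + 1)).grad x)
    simp only
    nlinarith [sq_nonneg (‖(u (m + 2)).grad x‖ - ‖(u (m + 1)).grad x‖)]
  have hself : ∫ x in Ω, inner ℝ ((u (m + 2)).grad x) ((u (m + 2)).grad x) =
      ∫ x in Ω, ‖(u (m + 2)).grad x‖ ^ 2 := by
    simp only [real_inner_self_eq_norm_sq]
  rw [hself] at hle
  have := mul_le_mul_of_nonneg_left hgrad (sq_nonneg ε)
  rw [modifiedEnergy_eq_integral α γ ε τ hM, modifiedEnergy_eq_integral α γ ε τ hM]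
  linarith

end

end TFAC

theorem mainTheorem4 {d : ℕ} (Ω : Set (EuclideanSpace ℝ (Fin d)))
    (hΩ : IsOpen Ω) (hΩb : Bornology.IsBounded Ω)
    (bc : TFAC.BoundaryCondition d) (hbc : bc.Admissible Ω)
    (α γ ε M S τ : ℝ) (hα0 : 0 < α) (hα1 : α < 1) (hγ : 0 < γ) (hε : 0 < ε) (hM : 1 ≤ M)
    (hτ : 0 < τ)
    (hS : 3 * α * (3 * M ^ 2 - 1) / (2 * (1 + α)) *
      (3 * γ * Real.Gamma (3 - α) * (3 * M ^ 2 - 1) / (2 * α * (1 + α))) ^ (1 / α) ≤ S)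
    (N : ℕ) (u : ℕ → TFAC.H1 Ω)
    (hu : ∀ n, n ≤ N → bc.EnergySpace (u n))
    (hscheme : ∀ n, 2 ≤ n → n ≤ N → TFAC.SchemeStep bc α γ ε M S τ u n) :
    ∀ n, 2 ≤ n → n ≤ N →
      TFAC.modifiedEnergy α γ ε M τ u n ≤ TFAC.modifiedEnergy α γ ε M τ u (n - 1) := by
  have : IsFiniteMeasure (volume.restrict Ω) :=
    isFiniteMeasure_restrict.2 hΩb.measure_lt_top.ne
  intro n hn hnN
  obtain ⟨m, rfl⟩ : ∃ m, n = m + 2 := ⟨n - 2, by lia⟩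
  exact (hscheme _ hn hnN).modifiedEnergy_le hα0 hα1 hγ hM hτ hS (hu _ (by lia))
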